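/- Let $\mathcal C$ be a monoidal dagger category: a monoidal category with an involutive, identity-on-objects contravariant functor $\dagger$ such that $(f\otimes g)^\dagger=f^\dagger\otimes g^\dagger$ and all coherence isomorphisms $\alpha\colon A\otimes(B\otimes D)\to(A\otimes B)\otimes D$, $\lambda\colon I\otimes A\to A$, $\rho\colon A\otimes I\to A$ are unitary (a morphism $f$ is unitary when $f^\dagger$ is its two-sided inverse). A *Frobenius monoid* in $\mathcal C$ is a monoid $(B,m,u)$ in $\mathcal C$ satisfying, up to the coherence isomorphism $\alpha$, $(m\otimes 1)\circ(1\otimes m^\dagger)=(1\otimes m)\circ(m^\dagger\otimes 1)$. Morphisms of Frobenius monoids are monoid homomorphisms. A *strong monad* on $\mathcal C$ is a monad $(T,\mu,\eta)$ with a natural transformation $\mathrm{st}_{A,B}\colon A\otimes T(B)\to T(A\otimes B)$ satisfying $\mathrm{st}\circ\alpha=T(\alpha)\circ\mathrm{st}\circ(1\otimes\mathrm{st})$, $T(\lambda)\circ\mathrm{st}=\lambda$, $\mathrm{st}\circ(1\otimes\mu)=\mu\circ T(\mathrm{st})\circ\mathrm{st}$ and $\mathrm{st}\circ(1\otimes\eta)=\eta$.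 A morphism of strong monads is a morphism of monads $\beta$ with $\beta\circ\mathrm{st}=\mathrm{st}\circ(1\otimes\beta)$. A *strong Frobenius monad* is a strong monad such that $T(f^\dagger)=T(f)^\dagger$ for all morphisms $f$, $T(\mu_A)\circ\mu_{T(A)}^\dagger=\mu_{T(A)}\circ T(\mu_A^\dagger)$ for all objects $A$, and every $\mathrm{st}_{A,B}$ is unitary. Morphisms of strong Frobenius monads are morphisms of strong monads. For a monoid $(B,m,u)$, the functor $-\otimes B$ is a strong monad with multiplication $(1_A\otimes m)\circ\alpha^{-1}\colon (A\otimes B)\otimes B\to A\otimes B$, unit $(1_A\otimes u)\circ\rho_A^{-1}$ and strength $\alpha$; a monoid homomorphism $f$ induces the morphism with components $1_A\otimes f$. For a strong monad $T$, the object $T(I)$ is a monoid with unit $\eta_I$ and multiplication $\mu_I\circ T(\rho_{T(I)})\circ\mathrm{st}_{T(I),I}$; a morphism $\beta$ of strong monads induces $\beta_I$. **Theorem.** If $B$ is a Frobenius monoid in $\mathcal C$ then $-\otimes B$ is a strong Frobenius monad, and if $T$ is a strong Frobenius monad on $\mathcal C$ then $T(I)$ is a Frobenius monoid. The resulting functors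 $B\mapsto -\otimes B$ and $T\mapsto T(I)$ are mutually inverse, up to natural isomorphism, and so form an equivalence between the category of Frobenius monoids in $\mathcal C$ and the category of strong Frobenius monads on $\mathcal C$. -/

import Mathlib

open CategoryTheory MonoidalCategory

universe v u

namespace DaggerMonad

/-- A dagger category: a contravariant involution that is the identity on objects. -/
class DaggerCategory (C : Type u) [Category.{v} C] where
  /-- The dagger of a morphism. -/
  dag : ∀ {A B : C}, (A ⟶ B) → (B ⟶ A)
  dag_id : ∀ A : C, dag (𝟙 A) = 𝟙 A
  dag_comp : ∀ {A B D : C} (f : A ⟶ B) (g : B ⟶ D), dag (f ≫ g) = dag g ≫ dag f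
  dag_dag : ∀ {A B : C} (f : A ⟶ B), dag (dag f) = f

/-- A morphism is unitary when its dagger is a two-sided inverse. -/
def IsUnitary {C : Type u} [Category.{v} C] [DaggerCategory C] {A B : C} (f : A ⟶ B) : Prop :=
  f ≫ DaggerCategory.dag f = 𝟙 A ∧ DaggerCategory.dag f ≫ f = 𝟙 B

/-- A monoidal dagger category: a monoidal category with a dagger that preserves tensor products
of morphisms and for which all coherence isomorphisms are unitary. -/
class MonoidalDaggerCategory (C : Type u) [Category.{v} C] [MonoidalCategory C] extends
    DaggerCategory C where
  dag_tensorHom : ∀ {A A' B B' : C} (f : A ⟶ A') (g : B ⟶ B'),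
    dag (f ⊗ₘ g) = dag f ⊗ₘ dag g
  associator_unitary : ∀ A B D : C, IsUnitary (α_ A B D).hom
  leftUnitor_unitary : ∀ A : C, IsUnitary (λ_ A).hom
  rightUnitor_unitary : ∀ A : C, IsUnitary (ρ_ A).hom

section Strong

variable (C : Type u) [Category.{v} C] [MonoidalCategory C]

/-- A strength `st : A ⊗ F B ⟶ F (A ⊗ B)` on an endofunctor. -/
structure Strength (F : C ⥤ C) where
  /-- The components of the strength. -/
  st : ∀ A B : C, A ⊗ F.obj B ⟶ F.obj (A ⊗ B)
  st_naturality : ∀ {A A' B B' : C} (f : A ⟶ A') (g : B ⟶ B'),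
    (f ⊗ₘ F.map g) ≫ st A' B' = st A B ≫ F.map (f ⊗ₘ g)
  st_assoc : ∀ A B D : C,
    (α_ A B (F.obj D)).inv ≫ st (A ⊗ B) D =
      A ◁ st B D ≫ st A (B ⊗ D) ≫ F.map (α_ A B D).inv
  st_unit : ∀ A : C, st (𝟙_ C) A ≫ F.map (λ_ A).hom = (λ_ (F.obj A)).hom

/-- A strong monad: a monad whose underlying functor carries a strength compatible with the
multiplication and the unit. -/
structure StrongMonad extends Monad C, Strength C toFunctor where
  st_mul : ∀ A B : C,
    A ◁ μ.app B ≫ st A B = st A (toFunctor.obj B) ≫ toFunctor.map (st A B) ≫ μ.app (A ⊗ B)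
  st_one : ∀ A B : C, A ◁ η.app B ≫ st A B = η.app (A ⊗ B)

variable {C}

/-- A morphism of strong monads: a natural transformation that is both a morphism of monads and
a morphism of strong functors. -/
@[ext]
structure StrongMonad.Hom (S T : StrongMonad C) where
  /-- The underlying morphism of monads. -/
  hom : S.toMonad ⟶ T.toMonad
  st_comp : ∀ A B : C, S.st A B ≫ hom.app (A ⊗ B) = A ◁ hom.app B ≫ T.st A B

instance : Category (StrongMonad C) where
  Hom S T := StrongMonad.Hom S T
  id S :=
    { hom := 𝟙 S.toMonad
      st_comp := fun A B => by simp }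
  comp f g :=
    { hom := f.hom ≫ g.hom
      st_comp := fun A B => by
        simp [reassoc_of% (f.st_comp A B), g.st_comp A B] }

/-- The monad `- ⊗ B` of a monoid `B`, with strength given by the associator. -/
def tensorStrongMonad (B : Mon C) : StrongMonad C where
  toFunctor := tensorRight B.X
  η :=
    { app := fun A => (ρ_ A).inv ≫ A ◁ MonObj.one (X := B.X)
      naturality := fun A A' f => by
        change f ≫ (ρ_ A').inv ≫ A' ◁ MonObj.one (X := B.X) =
          ((ρ_ A).inv ≫ A ◁ MonObj.one (X := B.X)) ≫ f ▷ B.X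
        rw [rightUnitor_inv_naturality_assoc, Category.assoc, whisker_exchange] }
  μ :=
    { app := fun A => (α_ A B.X B.X).hom ≫ A ◁ MonObj.mul (X := B.X)
      naturality := fun A A' f => by
        change (f ▷ B.X) ▷ B.X ≫ (α_ A' B.X B.X).hom ≫ A' ◁ MonObj.mul (X := B.X) =
          ((α_ A B.X B.X).hom ≫ A ◁ MonObj.mul (X := B.X)) ≫ f ▷ B.X
        rw [associator_naturality_left_assoc, Category.assoc, whisker_exchange] }
  assoc := fun A => by
    change ((α_ A B.X B.X).hom ≫ A ◁ MonObj.mul (X := B.X)) ▷ B.X ≫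
        (α_ A B.X B.X).hom ≫ A ◁ MonObj.mul (X := B.X) =
      ((α_ (A ⊗ B.X) B.X B.X).hom ≫ (A ⊗ B.X) ◁ MonObj.mul (X := B.X)) ≫
        (α_ A B.X B.X).hom ≫ A ◁ MonObj.mul (X := B.X)
    simp [← MonoidalCategory.whiskerLeft_comp]
    simp only [MonoidalCategory.whiskerLeft_comp, pentagon_assoc]
  left_unit := fun A => by
    change ((ρ_ (A ⊗ B.X)).inv ≫ (A ⊗ B.X) ◁ MonObj.one (X := B.X)) ≫
      (α_ A B.X B.X).hom ≫ A ◁ MonObj.mul (X := B.X) = 𝟙 (A ⊗ B.X)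
    simp [← MonoidalCategory.whiskerLeft_comp]
  right_unit := fun A => by
    change ((ρ_ A).inv ≫ A ◁ MonObj.one (X := B.X)) ▷ B.X ≫
      (α_ A B.X B.X).hom ≫ A ◁ MonObj.mul (X := B.X) = 𝟙 (A ⊗ B.X)
    simp [← MonoidalCategory.whiskerLeft_comp]
  st := fun A D => (α_ A D B.X).inv
  st_naturality := fun {A A' D D'} f g => by
    change (f ⊗ₘ g ▷ B.X) ≫ (α_ A' D' B.X).inv = (α_ A D B.X).inv ≫ (f ⊗ₘ g) ▷ B.X
    rw [← tensorHom_id, ← tensorHom_id, associator_inv_naturality]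
  st_assoc := fun A D E => by
    change (α_ A D (E ⊗ B.X)).inv ≫ (α_ (A ⊗ D) E B.X).inv =
      A ◁ (α_ D E B.X).inv ≫ (α_ A (D ⊗ E) B.X).inv ≫ (α_ A D E).inv ▷ B.X
    simp
  st_unit := fun A => by
    change (α_ (𝟙_ C) A B.X).inv ≫ (λ_ A).hom ▷ B.X = (λ_ (A ⊗ B.X)).hom
    simp
  st_mul := fun A D => by
    change A ◁ ((α_ D B.X B.X).hom ≫ D ◁ MonObj.mul (X := B.X)) ≫ (α_ A D B.X).inv =
      (α_ A (D ⊗ B.X) B.X).inv ≫ (α_ A D B.X).inv ▷ B.X ≫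
        (α_ (A ⊗ D) B.X B.X).hom ≫ (A ⊗ D) ◁ MonObj.mul (X := B.X)
    simp
  st_one := fun A D => by
    change A ◁ ((ρ_ D).inv ≫ D ◁ MonObj.one (X := B.X)) ≫ (α_ A D B.X).inv =
      (ρ_ (A ⊗ D)).inv ≫ (A ⊗ D) ◁ MonObj.one (X := B.X)
    simp

/-- `B ↦ - ⊗ B` as a functor from monoids to strong monads; a monoid homomorphism `f` is sent to
the transformation with components `A ◁ f`. -/
def tensorFunctor : Mon C ⥤ StrongMonad C where
  obj B := tensorStrongMonad B
  map {B B'} f :=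
    { hom :=
        { app := fun A => A ◁ f.hom
          naturality := fun A A' g => by
            change g ▷ B.X ≫ A' ◁ f.hom = A ◁ f.hom ≫ g ▷ B'.X
            rw [whisker_exchange]
          app_η := fun A => by
            change ((ρ_ A).inv ≫ A ◁ MonObj.one (X := B.X)) ≫ A ◁ f.hom =
              (ρ_ A).inv ≫ A ◁ MonObj.one (X := B'.X)
            simp [← MonoidalCategory.whiskerLeft_comp]
          app_μ := fun A => by
            change ((α_ A B.X B.X).hom ≫ A ◁ MonObj.mul (X := B.X)) ≫ A ◁ f.hom =
              ((A ◁ f.hom) ▷ B.X ≫ (A ⊗ B'.X) ◁ f.hom) ≫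
                (α_ A B'.X B'.X).hom ≫ A ◁ MonObj.mul (X := B'.X)
            simp [← MonoidalCategory.whiskerLeft_comp, MonoidalCategory.tensorHom_def] }
      st_comp := fun A D => by
        change (α_ A D B.X).inv ≫ (A ⊗ D) ◁ f.hom = A ◁ (D ◁ f.hom) ≫ (α_ A D B'.X).inv
        simp }
  map_id B := by
    apply StrongMonad.Hom.ext
    apply MonadHom.ext'
    funext A
    exact MonoidalCategory.whiskerLeft_id A B.X
  map_comp f g := by
    apply StrongMonad.Hom.ext
    apply MonadHom.ext'
    funext A
    exact MonoidalCategory.whiskerLeft_comp A f.hom g.hom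

/-- The monoid `T(I)` of a strong monad `T`, with unit `η_I` and multiplication
`T(I) ⊗ T(I) ⟶ T(T(I) ⊗ I) ⟶ T(T(I)) ⟶ T(I)`. -/
def evalMon (T : StrongMonad C) : Mon C where
  X := T.obj (𝟙_ C)
  mon :=
    { one := T.η.app (𝟙_ C)
      mul := T.st (T.obj (𝟙_ C)) (𝟙_ C) ≫ T.map (ρ_ (T.obj (𝟙_ C))).hom ≫ T.μ.app (𝟙_ C)
      one_mul := by
        have h := T.st_naturality (T.η.app (𝟙_ C)) (𝟙 (𝟙_ C))
        simp only [T.map_id, tensorHom_id] at h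
        have h2 := T.st_unit (𝟙_ C)
        rw [reassoc_of% h, ← Functor.map_comp_assoc, rightUnitor_naturality,
          Functor.map_comp_assoc, ← unitors_equal, reassoc_of% h2]
        exact (congrArg _ (T.right_unit (𝟙_ C))).trans (Category.comp_id _)
      mul_one := by
        have h := T.st_one (T.obj (𝟙_ C)) (𝟙_ C)
        rw [reassoc_of% h, ← T.unit_naturality_assoc]
        exact (congrArg _ (T.left_unit (𝟙_ C))).trans (Category.comp_id _)
      mul_assoc := by
        have nat := T.st_naturality
          (T.st (T.obj (𝟙_ C)) (𝟙_ C) ≫ T.map (ρ_ (T.obj (𝟙_ C))).hom ≫ T.μ.app (𝟙_ C)) (𝟙 (𝟙_ C))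
        simp only [T.map_id, tensorHom_id] at nat
        have nat' := T.st_naturality (𝟙 (T.obj (𝟙_ C))) (ρ_ (T.obj (𝟙_ C))).hom
        simp only [id_tensorHom] at nat'
        have hm := T.st_mul (T.obj (𝟙_ C)) (𝟙_ C)
        have ha := T.st_assoc (T.obj (𝟙_ C)) (T.obj (𝟙_ C)) (𝟙_ C)
        have ha' : (α_ (T.obj (𝟙_ C)) (T.obj (𝟙_ C)) (T.obj (𝟙_ C))).hom ≫
            T.obj (𝟙_ C) ◁ T.st (T.obj (𝟙_ C)) (𝟙_ C) ≫
              T.st (T.obj (𝟙_ C)) (T.obj (𝟙_ C) ⊗ 𝟙_ C) =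
            T.st (T.obj (𝟙_ C) ⊗ T.obj (𝟙_ C)) (𝟙_ C) ≫
              T.map (α_ (T.obj (𝟙_ C)) (T.obj (𝟙_ C)) (𝟙_ C)).hom := by
          rw [← Iso.eq_inv_comp, reassoc_of% ha, ← Functor.map_comp, Iso.inv_hom_id,
            CategoryTheory.Functor.map_id, Category.comp_id]
        have hμ := T.assoc (𝟙_ C)
        have lhs : T.map ((T.st (T.obj (𝟙_ C)) (𝟙_ C) ≫ T.map (ρ_ (T.obj (𝟙_ C))).hom ≫
              T.μ.app (𝟙_ C)) ▷ 𝟙_ C) ≫ T.map (ρ_ (T.obj (𝟙_ C))).hom =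
            T.map (ρ_ (T.obj (𝟙_ C) ⊗ T.obj (𝟙_ C))).hom ≫
              T.map (T.st (T.obj (𝟙_ C)) (𝟙_ C) ≫ T.map (ρ_ (T.obj (𝟙_ C))).hom ≫
                T.μ.app (𝟙_ C)) := by
          rw [← Functor.map_comp, ← Functor.map_comp, rightUnitor_naturality]
        rw [reassoc_of% nat, reassoc_of% lhs]
        simp only [MonoidalCategory.whiskerLeft_comp, Category.assoc]
        rw [reassoc_of% hm, ← T.mu_naturality_assoc, ← hμ, reassoc_of% nat', reassoc_of% ha',
          ← Functor.map_comp_assoc]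
        simp only [rightUnitor_tensor_hom, Functor.map_comp, Category.assoc] }

/-- `T ↦ T(I)` as a functor from strong monads to monoids; a morphism `β` is sent to its
component `β_I`. -/
def evalFunctor : StrongMonad C ⥤ Mon C where
  obj T := evalMon T
  map {S T} f :=
    Mon.Hom.mk' (M := evalMon S) (N := evalMon T) (f.hom.app (𝟙_ C))
      (f.hom.app_η (𝟙_ C))
      (by
        change (S.st (S.obj (𝟙_ C)) (𝟙_ C) ≫ S.map (ρ_ (S.obj (𝟙_ C))).hom ≫
            S.μ.app (𝟙_ C)) ≫ f.hom.app (𝟙_ C) =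
          (f.hom.app (𝟙_ C) ⊗ₘ f.hom.app (𝟙_ C)) ≫ T.st (T.obj (𝟙_ C)) (𝟙_ C) ≫
            T.map (ρ_ (T.obj (𝟙_ C))).hom ≫ T.μ.app (𝟙_ C)
        have hs := f.st_comp (S.obj (𝟙_ C)) (𝟙_ C)
        have nat := T.st_naturality (f.hom.app (𝟙_ C)) (𝟙 (𝟙_ C))
        simp only [T.map_id, tensorHom_id] at nat
        have hβ := f.hom.naturality (ρ_ (S.obj (𝟙_ C))).hom
        have hβ' := f.hom.naturality (f.hom.app (𝟙_ C))
        simp only [MonoidalCategory.tensorHom_def', Category.assoc]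
        rw [reassoc_of% nat,
          ← Functor.map_comp_assoc, rightUnitor_naturality, Functor.map_comp_assoc,
          ← reassoc_of% hs, ← reassoc_of% hβ]
        simp only [Category.assoc, f.hom.app_μ]
        rw [reassoc_of% hβ'])
  map_id T := by
    apply Mon.Hom.ext
    rfl
  map_comp f g := by
    apply Mon.Hom.ext
    rfl

end Strong

section Frobenius

open DaggerCategory MonObj

variable (C : Type u) [Category.{v} C] [MonoidalCategory C] [MonoidalDaggerCategory C]

/-- The Frobenius law for a monoid `B`: `(m ⊗ 1) ∘ (1 ⊗ m†) = (1 ⊗ m) ∘ (m† ⊗ 1)` as morphisms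
`B ⊗ B ⟶ B ⊗ B`. -/
def isFrobeniusMonoid : ObjectProperty (Mon C) := fun B =>
  B.X ◁ dag (mul (X := B.X)) ≫ (α_ B.X B.X B.X).inv ≫ mul (X := B.X) ▷ B.X =
    dag (mul (X := B.X)) ▷ B.X ≫ (α_ B.X B.X B.X).hom ≫ B.X ◁ mul (X := B.X)

/-- The category of Frobenius monoids and monoid homomorphisms. -/
abbrev FrobeniusMonoid := (isFrobeniusMonoid C).FullSubcategory

/-- A Frobenius monad on a dagger category: a monad on a dagger functor with
`T(μ_A) ∘ μ†_{T(A)} = μ_{T(A)} ∘ T(μ_A†)`. -/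
structure IsFrobeniusMonad {D : Type u} [Category.{v} D] [DaggerCategory D] (T : Monad D) :
    Prop where
  map_dag : ∀ {A B : D} (f : A ⟶ B), T.map (dag f) = dag (T.map f)
  frobenius : ∀ A : D,
    dag (T.μ.app (T.obj A)) ≫ T.map (T.μ.app A) = T.map (dag (T.μ.app A)) ≫ T.μ.app (T.obj A)

/-- A strong monad is a strong Frobenius monad when it is a Frobenius monad and its strength is
unitary. -/
def isStrongFrobeniusMonad : ObjectProperty (StrongMonad C) := fun T =>
  IsFrobeniusMonad T.toMonad ∧ ∀ A B : C, IsUnitary (T.st A B)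

/-- The category of strong Frobenius monads and morphisms of strong monads. -/
abbrev StrongFrobeniusMonad := (isStrongFrobeniusMonad C).FullSubcategory

end Frobenius

end DaggerMonad

/-!
Everything rests on the canonical map `θ_A : A ⊗ T(I) ⟶ T(A ⊗ I) ⟶ T(A)` of a strong monad `T`,
the strength followed by `T` of the right unitor (`StrongMonad.canonicalMap`). For every strong
monad it is a morphism of strong monads `- ⊗ T(I) ⟶ T` (`canonicalHom`), natural in `T`. When `T`
is a strong Frobenius monad, the strength is unitary and `T` preserves unitaries, so each `θ_A` is
unitary; hence `θ` is an isomorphism of strong monads, and it serves as the counit.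

Two facts make both functors restrict to the Frobenius objects. The Frobenius law of the monad
`- ⊗ B` at `A` is, up to associators, `A ◁ -` applied to the Frobenius law of `B`
(`tensor_frobenius_iff`); since `I ◁ -` is faithful, `- ⊗ B` is a Frobenius monad exactly when `B`
is a Frobenius monoid (`isFrobeniusMonad_tensor_iff`). And the Frobenius law is invariant under
unitary isomorphism of monads (`IsFrobeniusMonad.of_unitary_hom`). Applied to `θ`, the latter shows
that `- ⊗ T(I)` is a Frobenius monad, and by the former `T(I)` is then a Frobenius monoid, without
any computation with the multiplication of `T(I)`.

The other composite is naturally isomorphic to the identity by the left unitor `I ⊗ B ≅ B`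
(`evalTensorIso`).
-/

namespace DaggerMonad

open DaggerCategory MonObj

/-! ### Unitary morphisms and monads on dagger categories -/

section Dagger

variable {D : Type u} [Category.{v} D] [DaggerCategory D]

/-- A unitary morphism, bundled with its dagger as an isomorphism. -/
def IsUnitary.iso {A B : D} {f : A ⟶ B} (hf : IsUnitary f) : A ≅ B where
  hom := f
  inv := dag f
  hom_inv_id := hf.1
  inv_hom_id := hf.2

theorem IsUnitary.isIso {A B : D} {f : A ⟶ B} (hf : IsUnitary f) : IsIso f :=
  hf.iso.isIso_hom

theorem IsUnitary.dag {A B : D} {f : A ⟶ B} (hf : IsUnitary f) :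
    IsUnitary (DaggerCategory.dag f) := by
  rw [IsUnitary, dag_dag]
  exact ⟨hf.2, hf.1⟩

theorem IsUnitary.comp {A B E : D} {f : A ⟶ B} {g : B ⟶ E} (hf : IsUnitary f)
    (hg : IsUnitary g) : IsUnitary (f ≫ g) := by
  refine ⟨?_, ?_⟩
  · rw [dag_comp, Category.assoc, reassoc_of% hg.1, hf.1]
  · rw [dag_comp, Category.assoc, reassoc_of% hf.2, hg.2]

theorem IsUnitary.dag_eq_inv {A B : D} (e : A ≅ B) (h : IsUnitary e.hom) :
    DaggerCategory.dag e.hom = e.inv := by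
  rw [← cancel_epi e.hom, h.1, e.hom_inv_id]

theorem IsUnitary.map {F : D ⥤ D} (hF : ∀ {A B : D} (f : A ⟶ B), F.map (DaggerCategory.dag f) =
    DaggerCategory.dag (F.map f)) {A B : D} {f : A ⟶ B} (hf : IsUnitary f) :
    IsUnitary (F.map f) := by
  refine ⟨?_, ?_⟩
  · rw [← hF, ← F.map_comp, hf.1, F.map_id]
  · rw [← hF, ← F.map_comp, hf.2, F.map_id]

/-- The comultiplication `μ†` of a monad on a dagger functor is natural. -/
theorem dag_mu_naturality {T : Monad D}
    (hT : ∀ {A B : D} (f : A ⟶ B), T.map (dag f) = dag (T.map f)) {A B : D} (f : A ⟶ B) :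
    dag (T.μ.app A) ≫ T.map (T.map f) = T.map f ≫ dag (T.μ.app B) := by
  have h := congrArg dag (T.mu_naturality _ (dag f))
  simpa only [dag_comp, hT, dag_dag] using h

/-- The Frobenius law is invariant under unitary isomorphism of monads. -/
theorem IsFrobeniusMonad.of_unitary_hom {S T : Monad D} (φ : S ⟶ T)
    (hφ : ∀ A, IsUnitary (φ.app A)) (hT : IsFrobeniusMonad T) : IsFrobeniusMonad S := by
  have hdag : ∀ {A B : D} (f : A ⟶ B), S.map (dag f) = dag (S.map f) := by
    intro A B f
    have h := congrArg dag (φ.naturality f)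
    simp only [dag_comp] at h
    have := (hφ A).isIso
    have := (hφ B).dag.isIso
    rw [← cancel_mono (φ.app A), φ.naturality (dag f), hT.map_dag,
      ← cancel_epi (dag (φ.app B)), reassoc_of% h, (hφ A).2, Category.comp_id,
      reassoc_of% (hφ B).2]
  -- The horizontal composite `S.map (φ A) ≫ φ (T A)` of `φ` with itself is unitary, so taking
  -- daggers in `φ.app_μ` shows that `φ` also respects the comultiplications `μ†`.
  have hμ : ∀ A, dag (S.μ.app A) ≫ S.map (φ.app A) ≫ φ.app (T.obj A) =
      φ.app A ≫ dag (T.μ.app A) := by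
    intro A
    have hc : IsUnitary (S.map (φ.app A) ≫ φ.app (T.obj A)) := ((hφ A).map hdag).comp (hφ _)
    have h := congrArg dag (φ.app_μ A)
    rw [dag_comp, dag_comp (S.map _ ≫ _)] at h
    have := (hφ A).dag.isIso
    rw [← cancel_epi (dag (φ.app A)), reassoc_of% h, hc.2, Category.comp_id,
      reassoc_of% (hφ A).2]
  have nat {A B : D} (f : A ⟶ B) : S.map f ≫ φ.app B = φ.app A ≫ T.map f := φ.naturality f
  refine ⟨hdag, fun A => ?_⟩
  have hc : IsUnitary (S.map (φ.app A) ≫ φ.app (T.obj A)) := ((hφ A).map hdag).comp (hφ _)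
  -- The two ways of forming the triple horizontal composite of `φ` agree.
  have hcc : S.map (S.map (φ.app A) ≫ φ.app (T.obj A)) ≫ φ.app (T.obj (T.obj A)) =
      (S.map (φ.app (S.obj A)) ≫ φ.app (T.obj (S.obj A))) ≫ T.map (T.map (φ.app A)) := by
    rw [nat (φ.app A), S.map_comp, Category.assoc, Category.assoc, nat]
  -- Postcomposing with the horizontal composite moves both sides of the law from `S` to `T`.
  have := hc.isIso
  rw [← cancel_mono (S.map (φ.app A) ≫ φ.app (T.obj A))]
  calc (dag (S.μ.app (S.obj A)) ≫ S.map (S.μ.app A)) ≫ S.map (φ.app A) ≫ φ.app (T.obj A)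
      = dag (S.μ.app (S.obj A)) ≫ S.map (S.map (φ.app A) ≫ φ.app (T.obj A)) ≫
          φ.app (T.obj (T.obj A)) ≫ T.map (T.μ.app A) := by
        rw [← nat, Category.assoc, ← S.map_comp_assoc, φ.app_μ, S.map_comp_assoc]
    _ = φ.app (S.obj A) ≫ T.map (φ.app A) ≫ dag (T.μ.app (T.obj A)) ≫ T.map (T.μ.app A) := by
        rw [reassoc_of% hcc, reassoc_of% hμ (S.obj A),
          reassoc_of% dag_mu_naturality hT.map_dag (φ.app A)]
    _ = S.map (φ.app A) ≫ S.map (dag (T.μ.app A)) ≫ φ.app (T.obj (T.obj A)) ≫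
          T.μ.app (T.obj A) := by
        rw [hT.frobenius, reassoc_of% nat (dag (T.μ.app A)), reassoc_of% nat (φ.app A)]
    _ = S.map (dag (S.μ.app A)) ≫ S.map (S.map (φ.app A) ≫ φ.app (T.obj A)) ≫
          φ.app (T.obj (T.obj A)) ≫ T.μ.app (T.obj A) := by
        rw [← S.map_comp_assoc, ← S.map_comp_assoc, hμ]
    _ = (S.map (dag (S.μ.app A)) ≫ S.μ.app (S.obj A)) ≫ S.map (φ.app A) ≫ φ.app (T.obj A) := by
        have h := φ.app_μ (S.obj A)
        have h' := T.mu_naturality _ (φ.app A)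
        simp only [Category.assoc] at h hcc ⊢
        rw [reassoc_of% hcc, nat (φ.app A), reassoc_of% h, ← h']

end Dagger

/-! ### The canonical morphism from `- ⊗ T(I)` to `T` -/

section Monoidal

variable {C : Type u} [Category.{v} C] [MonoidalCategory C]

/-- An isomorphism of strong monads, from a morphism `φ` whose components are invertible; its
forward direction is `φ` itself. -/
def StrongMonad.isoOfComponents {S T : StrongMonad C} (φ : S ⟶ T)
    (e : ∀ A, S.obj A ≅ T.obj A) (he : ∀ A, (e A).hom = φ.hom.app A) : S ≅ T :=
  let i : S.toMonad ≅ T.toMonad :=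
    MonadIso.mk (NatIso.ofComponents e fun f => by
      rw [he, he]; exact φ.hom.naturality f)
      (fun A => by simp [he])
      (fun A => by simp [he])
  { hom := φ
    inv :=
      { hom := i.inv
        st_comp := fun A B => by
          change T.st A B ≫ (e (A ⊗ B)).inv = A ◁ (e B).inv ≫ S.st A B
          rw [Iso.comp_inv_eq, Category.assoc, he, φ.st_comp, ← he,
            whiskerLeft_inv_hom_assoc] }
    hom_inv_id := by
      apply StrongMonad.Hom.ext
      apply MonadHom.ext'
      funext A
      change φ.hom.app A ≫ (e A).inv = 𝟙 _
      rw [← he, Iso.hom_inv_id]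
    inv_hom_id := by
      apply StrongMonad.Hom.ext
      apply MonadHom.ext'
      funext A
      change (e A).inv ≫ φ.hom.app A = 𝟙 _
      rw [← he, Iso.inv_hom_id] }

/-- The canonical map `A ⊗ T(I) ⟶ T(A ⊗ I) ≅ T(A)` of a strong monad. -/
def StrongMonad.canonicalMap (T : StrongMonad C) (A : C) : A ⊗ T.obj (𝟙_ C) ⟶ T.obj A :=
  T.st A (𝟙_ C) ≫ T.map (ρ_ A).hom

theorem StrongMonad.canonicalMap_naturality (T : StrongMonad C) {A B : C} (f : A ⟶ B) :
    f ▷ T.obj (𝟙_ C) ≫ T.canonicalMap B = T.canonicalMap A ≫ T.map f := by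
  have h := T.st_naturality f (𝟙 (𝟙_ C))
  simp only [T.map_id, tensorHom_id] at h
  rw [canonicalMap, canonicalMap, reassoc_of% h, Category.assoc, ← T.map_comp, ← T.map_comp,
    rightUnitor_naturality]

/-- The canonical maps respect the strengths, that of `- ⊗ T(I)` being the inverse associator. -/
theorem StrongMonad.canonicalMap_tensor (T : StrongMonad C) (A B : C) :
    (α_ A B (T.obj (𝟙_ C))).inv ≫ T.canonicalMap (A ⊗ B) =
      A ◁ T.canonicalMap B ≫ T.st A B := by
  have h := T.st_naturality (𝟙 A) (ρ_ B).hom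
  simp only [id_tensorHom] at h
  rw [canonicalMap, canonicalMap, reassoc_of% T.st_assoc, ← T.map_comp, whiskerLeft_comp,
    Category.assoc, h]
  simp

/-- The canonical maps respect the units of `- ⊗ T(I)` and `T`. -/
theorem StrongMonad.canonicalMap_unit (T : StrongMonad C) (A : C) :
    ((ρ_ A).inv ≫ A ◁ T.η.app (𝟙_ C)) ≫ T.canonicalMap A = T.η.app A := by
  have h := T.st_one A (𝟙_ C)
  rw [canonicalMap, Category.assoc, reassoc_of% h, ← T.unit_naturality, Iso.inv_hom_id_assoc]

theorem evalMon_mul (T : StrongMonad C) :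
    mul (X := (evalMon T).X) = T.canonicalMap (T.obj (𝟙_ C)) ≫ T.μ.app (𝟙_ C) :=
  (Category.assoc _ _ _).symm

/-- The canonical maps respect the multiplications of `- ⊗ T(I)` and `T`; here the multiplication
of `T(I)` is written as in `evalMon_mul`. -/
theorem StrongMonad.canonicalMap_mul (T : StrongMonad C) (A : C) :
    ((α_ A (T.obj (𝟙_ C)) (T.obj (𝟙_ C))).hom ≫
        A ◁ (T.canonicalMap (T.obj (𝟙_ C)) ≫ T.μ.app (𝟙_ C))) ≫ T.canonicalMap A =
      (T.canonicalMap A ▷ T.obj (𝟙_ C) ≫ T.canonicalMap (T.obj A)) ≫ T.μ.app A := by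
  have hm := T.st_mul A (𝟙_ C)
  have hn := T.mu_naturality _ (ρ_ A).hom
  have ht : A ◁ T.canonicalMap (T.obj (𝟙_ C)) ≫ T.st A (T.obj (𝟙_ C)) = _ :=
    (T.canonicalMap_tensor A (T.obj (𝟙_ C))).symm
  rw [T.canonicalMap_naturality, Category.assoc, canonicalMap.eq_def T A, T.map_comp,
    whiskerLeft_comp, Category.assoc, Category.assoc, reassoc_of% hm, reassoc_of% ht,
    Iso.hom_inv_id_assoc, ← hn, Category.assoc]

/-- The morphism of strong monads `- ⊗ T(I) ⟶ T` given by the canonical maps. -/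
def canonicalHom (T : StrongMonad C) : tensorStrongMonad (evalMon T) ⟶ T where
  hom :=
    { app := T.canonicalMap
      naturality := fun _ _ f => T.canonicalMap_naturality f
      app_η := T.canonicalMap_unit
      app_μ := fun A => by
        change ((α_ A (T.obj (𝟙_ C)) (T.obj (𝟙_ C))).hom ≫
          A ◁ mul (X := (evalMon T).X)) ≫ T.canonicalMap A = _
        rw [evalMon_mul]
        exact T.canonicalMap_mul A }
  st_comp := T.canonicalMap_tensor

/-- The canonical morphism is natural in `T`. -/
theorem canonicalHom_naturality {S T : StrongMonad C} (f : S ⟶ T) :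
    tensorFunctor.map (evalFunctor.map f) ≫ canonicalHom T = canonicalHom S ≫ f := by
  apply StrongMonad.Hom.ext
  apply MonadHom.ext'
  funext A
  have hs := f.st_comp A (𝟙_ C)
  have hn := f.hom.naturality (ρ_ A).hom
  change A ◁ f.hom.app (𝟙_ C) ≫ T.st A (𝟙_ C) ≫ T.map (ρ_ A).hom =
    (S.st A (𝟙_ C) ≫ S.map (ρ_ A).hom) ≫ f.hom.app A
  rw [← reassoc_of% hs, Category.assoc]
  exact congrArg _ hn.symm

/-- A monoid `B` is recovered from the strong monad `- ⊗ B`: the left unitor `I ⊗ B ≅ B` is an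
isomorphism of monoids. -/
def evalTensorIso (B : Mon C) : evalMon (tensorStrongMonad B) ≅ B :=
  Mon.mkIso (M := evalMon (tensorStrongMonad B)) (λ_ B.X)
    (by
      change ((ρ_ (𝟙_ C)).inv ≫ 𝟙_ C ◁ one (X := B.X)) ≫ (λ_ B.X).hom = one (X := B.X)
      simp [unitors_equal])
    (by
      change ((α_ (𝟙_ C ⊗ B.X) (𝟙_ C) B.X).inv ≫ (ρ_ (𝟙_ C ⊗ B.X)).hom ▷ B.X ≫
        (α_ (𝟙_ C) B.X B.X).hom ≫ 𝟙_ C ◁ mul (X := B.X)) ≫ (λ_ B.X).hom =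
          ((λ_ B.X).hom ⊗ₘ (λ_ B.X).hom) ≫ mul (X := B.X)
      simp [MonoidalCategory.tensorHom_def])

end Monoidal

/-! ### Frobenius monoids and strong Frobenius monads -/

section Frobenius

variable {C : Type u} [Category.{v} C] [MonoidalCategory C] [MonoidalDaggerCategory C]

theorem dag_whiskerRight {A B : C} (f : A ⟶ B) (D : C) : dag (f ▷ D) = dag f ▷ D := by
  rw [← tensorHom_id, MonoidalDaggerCategory.dag_tensorHom, dag_id, tensorHom_id]

theorem dag_whiskerLeft (D : C) {A B : C} (f : A ⟶ B) : dag (D ◁ f) = D ◁ dag f := by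
  rw [← id_tensorHom, MonoidalDaggerCategory.dag_tensorHom, dag_id, id_tensorHom]

theorem dag_associator_hom (A B D : C) : dag (α_ A B D).hom = (α_ A B D).inv :=
  IsUnitary.dag_eq_inv _ (MonoidalDaggerCategory.associator_unitary A B D)

theorem dag_associator_inv (A B D : C) : dag (α_ A B D).inv = (α_ A B D).hom := by
  rw [← dag_associator_hom, dag_dag]

/-- The two sides of the Frobenius law for the monad `- ⊗ B` at `A` are, up to associators,
`A ◁ -` applied to the two sides of the Frobenius law for `B`. -/
theorem tensor_frobenius_iff (B : Mon C) (A : C) :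
    (dag ((tensorStrongMonad B).μ.app ((tensorStrongMonad B).obj A)) ≫
        (tensorStrongMonad B).map ((tensorStrongMonad B).μ.app A) =
      (tensorStrongMonad B).map (dag ((tensorStrongMonad B).μ.app A)) ≫
        (tensorStrongMonad B).μ.app ((tensorStrongMonad B).obj A)) ↔
    A ◁ (B.X ◁ dag (mul (X := B.X)) ≫ (α_ B.X B.X B.X).inv ≫ mul (X := B.X) ▷ B.X) =
      A ◁ (dag (mul (X := B.X)) ▷ B.X ≫ (α_ B.X B.X B.X).hom ≫ B.X ◁ mul (X := B.X)) := by
  change dag ((α_ (A ⊗ B.X) B.X B.X).hom ≫ (A ⊗ B.X) ◁ mul (X := B.X)) ≫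
        ((α_ A B.X B.X).hom ≫ A ◁ mul (X := B.X)) ▷ B.X =
      dag ((α_ A B.X B.X).hom ≫ A ◁ mul (X := B.X)) ▷ B.X ≫
        (α_ (A ⊗ B.X) B.X B.X).hom ≫ (A ⊗ B.X) ◁ mul (X := B.X) ↔ _
  have hl : dag ((α_ (A ⊗ B.X) B.X B.X).hom ≫ (A ⊗ B.X) ◁ mul (X := B.X)) ≫
        ((α_ A B.X B.X).hom ≫ A ◁ mul (X := B.X)) ▷ B.X = (α_ A B.X B.X).hom ≫
      A ◁ (B.X ◁ dag (mul (X := B.X)) ≫ (α_ B.X B.X B.X).inv ≫ mul (X := B.X) ▷ B.X) ≫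
        (α_ A B.X B.X).inv := by
    simp [dag_comp, dag_associator_hom, dag_associator_inv, dag_whiskerLeft]
  have hr : dag ((α_ A B.X B.X).hom ≫ A ◁ mul (X := B.X)) ▷ B.X ≫
        (α_ (A ⊗ B.X) B.X B.X).hom ≫ (A ⊗ B.X) ◁ mul (X := B.X) = (α_ A B.X B.X).hom ≫
      A ◁ (dag (mul (X := B.X)) ▷ B.X ≫ (α_ B.X B.X B.X).hom ≫ B.X ◁ mul (X := B.X)) ≫
        (α_ A B.X B.X).inv := by
    simp [dag_comp, dag_associator_hom, dag_whiskerLeft]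
  rw [hl, hr, cancel_epi, cancel_mono]

theorem isFrobeniusMonad_tensor_iff (B : Mon C) :
    IsFrobeniusMonad (tensorStrongMonad B).toMonad ↔ isFrobeniusMonoid C B := by
  constructor
  · intro h
    have h' := (tensor_frobenius_iff B (𝟙_ C)).1 (h.frobenius (𝟙_ C))
    exact (MonoidalCategory.whiskerLeft_iff _ _).1 h'
  · intro h
    exact ⟨fun f => (dag_whiskerRight f B.X).symm, fun A =>
      (tensor_frobenius_iff B A).2 (congrArg (A ◁ ·) h)⟩

theorem isStrongFrobeniusMonad_tensor {B : Mon C} (h : isFrobeniusMonoid C B) :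
    isStrongFrobeniusMonad C (tensorFunctor.obj B) := by
  refine ⟨(isFrobeniusMonad_tensor_iff B).2 h, fun A D => ?_⟩
  change IsUnitary (α_ A D B.X).inv
  rw [← dag_associator_hom]
  exact (MonoidalDaggerCategory.associator_unitary A D B.X).dag

theorem isUnitary_canonicalMap {T : StrongMonad C} (hT : isStrongFrobeniusMonad C T) (A : C) :
    IsUnitary (T.canonicalMap A) :=
  (hT.2 A (𝟙_ C)).comp ((MonoidalDaggerCategory.rightUnitor_unitary A).map hT.1.map_dag)

/-- The monad `- ⊗ T(I)` inherits the Frobenius law from `T` along the unitary canonical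
morphism, so `T(I)` is a Frobenius monoid. -/
theorem isFrobeniusMonoid_eval {T : StrongMonad C} (hT : isStrongFrobeniusMonad C T) :
    isFrobeniusMonoid C (evalFunctor.obj T) :=
  (isFrobeniusMonad_tensor_iff (evalMon T)).1
    (hT.1.of_unitary_hom (canonicalHom T).hom (isUnitary_canonicalMap hT))

end Frobenius

end DaggerMonad

/-! ### The equivalence of categories -/

open DaggerMonad in
theorem mainTheorem2 (C : Type u) [Category.{v} C] [MonoidalCategory C]
    [MonoidalDaggerCategory C] :
    ∃ (hF : ∀ B : FrobeniusMonoid C, isStrongFrobeniusMonad C (tensorFunctor.obj B.obj))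
      (hE : ∀ T : StrongFrobeniusMonad C, isFrobeniusMonoid C (evalFunctor.obj T.obj))
      (e : FrobeniusMonoid C ≌ StrongFrobeniusMonad C),
      e.functor =
        (isStrongFrobeniusMonad C).lift ((isFrobeniusMonoid C).ι ⋙ tensorFunctor) hF ∧
      e.inverse =
        (isFrobeniusMonoid C).lift ((isStrongFrobeniusMonad C).ι ⋙ evalFunctor) hE := by
  have hF (B : FrobeniusMonoid C) : isStrongFrobeniusMonad C (tensorFunctor.obj B.obj) :=
    isStrongFrobeniusMonad_tensor B.property
  have hE (T : StrongFrobeniusMonad C) : isFrobeniusMonoid C (evalFunctor.obj T.obj) :=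
    isFrobeniusMonoid_eval T.property
  let F := (isStrongFrobeniusMonad C).lift ((isFrobeniusMonoid C).ι ⋙ tensorFunctor) hF
  let G := (isFrobeniusMonoid C).lift ((isStrongFrobeniusMonad C).ι ⋙ evalFunctor) hE
  let unit : 𝟭 _ ≅ F ⋙ G := NatIso.ofComponents
    (fun B => (isFrobeniusMonoid C).isoMk (evalTensorIso B.obj).symm) fun f => by
      apply ObjectProperty.hom_ext
      apply Mon.Hom.ext
      exact leftUnitor_inv_naturality f.hom.hom
  let counit : G ⋙ F ≅ 𝟭 _ := NatIso.ofComponents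
    (fun T => (isStrongFrobeniusMonad C).isoMk
      (StrongMonad.isoOfComponents (canonicalHom T.obj)
        (fun A => (isUnitary_canonicalMap T.property A).iso) fun _ => rfl)) fun f => by
      apply ObjectProperty.hom_ext
      exact canonicalHom_naturality f.hom
  -- `Equivalence.mk` may correct the unit for the triangle identity, but keeps both functors.
  exact ⟨hF, hE, CategoryTheory.Equivalence.mk F G unit counit, rfl, rfl⟩
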